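/- Consider a market with $m$ buyers and $n$ divisible goods. The seller has a supply bundle $s\in\mathbb{R}^n_{\ge 0}$; buyer $i$ has a budget $\beta^i\ge 0$ and a linear valuation $x\mapsto v^i\cdot x$ with $v^i\in\mathbb{R}^n_{\ge 0}$. Assume that every good is valued positively by at least one buyer with a positive budget. The utility of buyer $i$ from the bundle $x\in\mathbb{R}^n_{\ge 0}$ at prices $p\in\mathbb{R}^n_{\ge 0}$ is $v^i\cdot x+\beta^i-p\cdot x$, and his demand $D^i(p)$ is the set of bundles $x\in\mathbb{R}^n_{\ge0}$ that maximise this utility subject to $p\cdot x\le\beta^i$. An outcome $(p,(x^i))$, consisting of prices $p\in\mathbb{R}^n_{\ge 0}$ and a bundle $x^i$ for each buyer, is *feasible* if $\sum_i x^i\le s$ and $x^i\in D^i(p)$ for every $i$. It is a *competitive equilibrium* if moreover $\sum_i x^i_j=s_j$ for every good $j$ with $p_j>0$. Prices are *feasible* (respectively *market-clearing*) if some allocation extends them to a feasible outcome (respectively to a competitive equilibrium). Proposition. There is an elementwise-smallest feasible price vector $p^*$, that is, $p^*$ is feasible and $p^*\le p$ for all feasible $p$. The prices $p^*$ are market-clearing,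 and every market-clearing price vector $q$ satisfies $q_j=p^*_j$ for each good $j$ with $s_j>0$. In particular, if $s_j>0$ for all goods $j$, then $p^*$ is the unique market-clearing price vector. -/

import Mathlib

open scoped BigOperators

/-- A market for `n` divisible goods with `m` buyers: each buyer has a budget and a valuation of
bundles of goods, and the seller owns a supply bundle. -/
structure Market (m n : ℕ) where
  /-- The budget of each buyer. -/
  budget : Fin m → ℝ
  /-- The valuation of each buyer; only its values at non-negative bundles are ever used. -/
  valuation : Fin m → (Fin n → ℝ) → ℝ
  /-- The quantity of each good that the seller owns. -/
  supply : Fin n → ℝ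

namespace Market

variable {m n : ℕ}

/-- The market in which buyer `i` has the linear valuation `x ↦ v i ⬝ᵥ x`. -/
def linear (v : Fin m → Fin n → ℝ) (β : Fin m → ℝ) (s : Fin n → ℝ) : Market m n where
  budget := β
  valuation := fun i x => v i ⬝ᵥ x
  supply := s

/-- The quasi-linear utility of buyer `i` from the bundle `x` at prices `p`: the value of the bundle
plus the leftover money. -/
def utility (M : Market m n) (i : Fin m) (x p : Fin n → ℝ) : ℝ :=
  M.valuation i x + M.budget i - p ⬝ᵥ x

/-- The non-negative bundles that buyer `i` can afford at prices `p`. -/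
def budgetSet (M : Market m n) (i : Fin m) (p : Fin n → ℝ) : Set (Fin n → ℝ) :=
  {x | 0 ≤ x ∧ p ⬝ᵥ x ≤ M.budget i}

/-- The demand correspondence: the affordable bundles that maximise the utility of buyer `i`. -/
def demand (M : Market m n) (i : Fin m) (p : Fin n → ℝ) : Set (Fin n → ℝ) :=
  {x | x ∈ M.budgetSet i p ∧ ∀ y ∈ M.budgetSet i p, M.utility i y p ≤ M.utility i x p}

/-- The outcome with prices `p` and allocation `x` is feasible: prices are non-negative, the
allocation does not exceed supply, and each buyer demands his allocation. -/
def IsFeasibleOutcome (M : Market m n) (p : Fin n → ℝ) (x : Fin m → Fin n → ℝ) : Prop :=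
  0 ≤ p ∧ (∀ j, ∑ i, x i j ≤ M.supply j) ∧ ∀ i, x i ∈ M.demand i p

/-- The feasible region: the prices that some allocation extends to a feasible outcome. -/
def feasibleRegion (M : Market m n) : Set (Fin n → ℝ) :=
  {p | ∃ x, M.IsFeasibleOutcome p x}

/-- A competitive equilibrium: a feasible outcome that clears the market for all goods with a
positive price. -/
def IsCompetitiveEquilibrium (M : Market m n) (p : Fin n → ℝ) (x : Fin m → Fin n → ℝ) : Prop :=
  M.IsFeasibleOutcome p x ∧ ∀ j, 0 < p j → ∑ i, x i j = M.supply j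

/-- Market-clearing (competitive equilibrium) prices: the prices that some allocation extends to a
competitive equilibrium. -/
def IsMarketClearing (M : Market m n) (p : Fin n → ℝ) : Prop :=
  ∃ x, M.IsCompetitiveEquilibrium p x

end Market

/-! For a linear buyer, demand is described by complementary slackness. A multiplier `l i ≥ 1`, the
marginal utility of money, satisfies `v i j ≤ l i * p j`, with equality on the goods bought, and
money is left over only if `l i = 1`. `IsSupported` records this system, and
`mem_feasibleRegion_iff` identifies its prices with the feasible ones.

Smallest prices: `IsSupported.inf` gives each buyer the bundle belonging to his larger multiplier,
so supported prices are closed under minima. Compactness then yields a least element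
(`exists_isLeast_supported`).

Clearing: at the least prices, take an allocation of maximal revenue and, among these, with a
minimal set of sold-out goods. If some good were undersold, every buyer willing to buy undersold
goods would spend his whole budget on such goods, so their prices could all be scaled down
(`IsSupported.exists_lower`), contradicting minimality.

Uniqueness: if clearing prices `q` exceed `p` on a set of goods, no buyer spends more on that set at
`q` than at `p`, yet selling its supply at `q` earns more (`IsSupported.eq_of_clearing`). -/

namespace Market

/-! ### Demand and its optimality multipliers. -/

variable {m n : ℕ} {v : Fin m → Fin n → ℝ} {β : Fin m → ℝ} {s : Fin n → ℝ}

/-- The allocation `x` is feasible at prices `p`, and its optimality for the buyers is witnessed by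
the multipliers `l`: `l i` is the marginal utility of money of buyer `i`. -/
structure IsSupported (v : Fin m → Fin n → ℝ) (β : Fin m → ℝ) (s : Fin n → ℝ)
    (p : Fin n → ℝ) (x : Fin m → Fin n → ℝ) (l : Fin m → ℝ) : Prop where
  price_nonneg : ∀ j, 0 ≤ p j
  alloc_nonneg : ∀ i j, 0 ≤ x i j
  supply : ∀ j, ∑ i, x i j ≤ s j
  budget : ∀ i, ∑ j, p j * x i j ≤ β i
  one_le : ∀ i, 1 ≤ l i
  valuation_le : ∀ i, 0 < β i → ∀ j, v i j ≤ l i * p j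
  tight : ∀ i j, x i j * (l i * p j - v i j) = 0
  exhausts : ∀ i, (l i - 1) * (β i - ∑ j, p j * x i j) = 0
  eq_one : ∀ i, β i = 0 → l i = 1

theorem utility_linear (i : Fin m) (x p : Fin n → ℝ) :
    (linear v β s).utility i x p = ∑ j, v i j * x j + β i - ∑ j, p j * x j := rfl

theorem mem_budgetSet_linear {i : Fin m} {x p : Fin n → ℝ} :
    x ∈ (linear v β s).budgetSet i p ↔ (∀ j, 0 ≤ x j) ∧ ∑ j, p j * x j ≤ β i := Iff.rfl

theorem sum_mul_add_single (p x : Fin n → ℝ) (k : Fin n) (c : ℝ) :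
    ∑ j, p j * (x + Pi.single k c : Fin n → ℝ) j = ∑ j, p j * x j + p k * c := by
  have h : p ⬝ᵥ (x + Pi.single k c) = p ⬝ᵥ x + p k * c := by
    rw [dotProduct_add, dotProduct_single]
  exact h

theorem sum_mul_single (p : Fin n → ℝ) (k : Fin n) (c : ℝ) :
    ∑ j, p j * (Pi.single k c : Fin n → ℝ) j = p k * c :=
  dotProduct_single p c k

namespace IsSupported

variable {p : Fin n → ℝ} {x : Fin m → Fin n → ℝ} {l : Fin m → ℝ}

theorem price_pos (h : IsSupported v β s p x l) (hval : ∀ j, ∃ i, 0 < β i ∧ 0 < v i j)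
    (j : Fin n) : 0 < p j := by
  obtain ⟨i, hi, hij⟩ := hval j
  have h1 := h.valuation_le i hi j
  have h2 := h.one_le i
  by_contra hp
  have : l i * p j ≤ 0 := mul_nonpos_of_nonneg_of_nonpos (by linarith) (not_lt.1 hp)
  linarith

theorem alloc_eq_zero (h : IsSupported v β s p x l) (hp : ∀ j, 0 < p j) {i : Fin m}
    (hi : β i = 0) (j : Fin n) : x i j = 0 := by
  have hn : ∀ k ∈ Finset.univ, 0 ≤ p k * x i k := fun k _ =>
    mul_nonneg (hp k).le (h.alloc_nonneg i k)
  have h0 : ∑ k, p k * x i k = 0 :=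
    le_antisymm (hi ▸ h.budget i) (Finset.sum_nonneg hn)
  have := (Finset.sum_eq_zero_iff_of_nonneg hn).1 h0 j (Finset.mem_univ j)
  exact (mul_eq_zero.1 this).resolve_left (hp j).ne'

theorem valuation_eq (h : IsSupported v β s p x l) {i : Fin m} {j : Fin n} (hx : x i j ≠ 0) :
    v i j = l i * p j := by
  have := (mul_eq_zero.1 (h.tight i j)).resolve_left hx
  linarith

theorem spend_eq (h : IsSupported v β s p x l) {i : Fin m} (hl : 1 < l i) :
    ∑ j, p j * x i j = β i := by
  have := (mul_eq_zero.1 (h.exhausts i)).resolve_left (by linarith)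
  linarith

theorem sum_valuation (h : IsSupported v β s p x l) (i : Fin m) :
    ∑ j, v i j * x i j = l i * ∑ j, p j * x i j := by
  rw [Finset.mul_sum]
  refine Finset.sum_congr rfl fun j _ => ?_
  linear_combination -h.tight i j

/-- Supplies the bound needed for compactness. If `l i > 1` the budget is exhausted, so `l i * β i`
is the value of the bundle. For `β i = 0` the quotient is `0` by convention, in agreement with
`eq_one`. -/
theorem multiplier_le (h : IsSupported v β s p x l) (hv : ∀ i j, 0 ≤ v i j) (hβ : ∀ i, 0 ≤ β i)
    (hs : ∀ j, 0 ≤ s j) (i : Fin m) : l i ≤ 1 + (∑ j, v i j * s j) / β i := by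
  have hvs : 0 ≤ ∑ j, v i j * s j := Finset.sum_nonneg fun j _ => mul_nonneg (hv i j) (hs j)
  have hq : 0 ≤ (∑ j, v i j * s j) / β i := div_nonneg hvs (hβ i)
  rcases (h.one_le i).eq_or_lt with h1 | h1
  · linarith
  have hi : 0 < β i := (hβ i).lt_of_ne fun h0 => h1.ne' (h.eq_one i h0.symm)
  have hle : l i * β i ≤ ∑ j, v i j * s j := by
    rw [← h.spend_eq h1, ← h.sum_valuation i]
    refine Finset.sum_le_sum fun j _ => mul_le_mul_of_nonneg_left ?_ (hv i j)
    exact (Finset.single_le_sum (f := fun i => x i j) (fun k _ => h.alloc_nonneg k j)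
      (Finset.mem_univ i)).trans (h.supply j)
  have := (le_div_iff₀ hi).2 hle
  linarith

/-- Weak duality: an affordable bundle has net gain at most `(l i - 1) * β i`, attained by `x i`.
Zero budgets are separate because `valuation_le` does not cover them; positive prices then force the
zero bundle. -/
theorem isFeasibleOutcome (h : IsSupported v β s p x l) (hp : ∀ j, 0 < p j)
    (hβ : ∀ i, 0 ≤ β i) : (linear v β s).IsFeasibleOutcome p x := by
  refine ⟨h.price_nonneg, h.supply, fun i => ⟨⟨h.alloc_nonneg i, h.budget i⟩, fun y hy => ?_⟩⟩
  rw [mem_budgetSet_linear] at hy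
  rw [utility_linear, utility_linear]
  rcases (hβ i).eq_or_lt with hi | hi
  · have hn : ∀ k ∈ Finset.univ, 0 ≤ p k * y k := fun k _ => mul_nonneg (hp k).le (hy.1 k)
    have h0 : ∑ k, p k * y k = 0 := le_antisymm (hi ▸ hy.2) (Finset.sum_nonneg hn)
    have hy0 : ∀ k, y k = 0 := fun k => (mul_eq_zero.1
      ((Finset.sum_eq_zero_iff_of_nonneg hn).1 h0 k (Finset.mem_univ k))).resolve_left (hp k).ne'
    simp [hy0, h.alloc_eq_zero hp hi.symm]
  · have h1 : ∑ j, v i j * y j ≤ l i * ∑ j, p j * y j := by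
      rw [Finset.mul_sum]
      refine Finset.sum_le_sum fun j _ => ?_
      rw [← mul_assoc]
      exact mul_le_mul_of_nonneg_right (h.valuation_le i hi j) (hy.1 j)
    have h2 : (l i - 1) * ∑ j, p j * y j ≤ (l i - 1) * β i :=
      mul_le_mul_of_nonneg_left hy.2 (by linarith [h.one_le i])
    have h3 := h.sum_valuation i
    have h4 := h.exhausts i
    linarith

end IsSupported

/-- The marginal utility of money of a buyer with values `w` at positive prices `p`. -/
theorem exists_multiplier (w p : Fin n → ℝ) (hp : ∀ j, 0 < p j) :
    ∃ c : ℝ, 1 ≤ c ∧ (∀ j, w j ≤ c * p j) ∧ (c = 1 ∨ ∃ k, w k = c * p k) := by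
  by_cases hle : ∀ j, w j ≤ p j
  · exact ⟨1, le_rfl, fun j => by simpa using hle j, Or.inl rfl⟩
  push Not at hle
  obtain ⟨j₀, hj₀⟩ := hle
  obtain ⟨k, -, hk⟩ := Finset.exists_max_image Finset.univ (fun j => w j / p j)
    ⟨j₀, Finset.mem_univ j₀⟩
  refine ⟨w k / p k, ?_, fun j => ?_, Or.inr ⟨k, ?_⟩⟩
  · exact ((one_le_div (hp j₀)).2 hj₀.le).trans (hk j₀ (Finset.mem_univ _))
  · exact (div_le_iff₀ (hp j)).1 (hk j (Finset.mem_univ _))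
  · exact (div_mul_cancel₀ _ (hp k).ne').symm

theorem IsFeasibleOutcome.price_pos {p : Fin n → ℝ} {x : Fin m → Fin n → ℝ}
    (h : (linear v β s).IsFeasibleOutcome p x) (hval : ∀ j, ∃ i, 0 < β i ∧ 0 < v i j)
    (j : Fin n) : 0 < p j := by
  refine (h.1 j).lt_of_ne fun h0 => ?_
  have h0' : p j = 0 := h0.symm
  obtain ⟨i, -, hij⟩ := hval j
  obtain ⟨hb, hmax⟩ := h.2.2 i
  rw [mem_budgetSet_linear] at hb
  have := hmax (x i + Pi.single j 1) (by
    rw [mem_budgetSet_linear, sum_mul_add_single, h0']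
    refine ⟨fun k => add_nonneg (hb.1 k) ?_, by linarith [hb.2]⟩
    exact (Pi.single_nonneg.2 zero_le_one : (0 : Fin n → ℝ) ≤ Pi.single j 1) k)
  rw [utility_linear, utility_linear, sum_mul_add_single, sum_mul_add_single, h0'] at this
  linarith

/-- Compare `x i` with the empty bundle or with the whole budget spent on a good of best value per
unit of money. The resulting inequality says that the two nonnegative slackness terms have sum at
most zero. -/
theorem IsFeasibleOutcome.exists_isSupported {p : Fin n → ℝ} {x : Fin m → Fin n → ℝ}
    (h : (linear v β s).IsFeasibleOutcome p x) (hβ : ∀ i, 0 ≤ β i)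
    (hval : ∀ j, ∃ i, 0 < β i ∧ 0 < v i j) : ∃ l, IsSupported v β s p x l := by
  have hp := h.price_pos hval
  have hb : ∀ i, (∀ j, 0 ≤ x i j) ∧ ∑ j, p j * x i j ≤ β i := fun i =>
    mem_budgetSet_linear.1 (h.2.2 i).1
  choose c hc1 hcle hc using fun i => exists_multiplier (v i) p hp
  have key : ∀ i, (∀ j, x i j * (c i * p j - v i j) = 0) ∧
      (c i - 1) * (β i - ∑ j, p j * x i j) = 0 := by
    intro i
    have hn : ∀ j ∈ Finset.univ, 0 ≤ x i j * (c i * p j - v i j) := fun j _ =>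
      mul_nonneg ((hb i).1 j) (by linarith [hcle i j])
    have hsum : ∑ j, x i j * (c i * p j - v i j) =
        c i * ∑ j, p j * x i j - ∑ j, v i j * x i j := by
      rw [Finset.mul_sum, ← Finset.sum_sub_distrib]
      exact Finset.sum_congr rfl fun j _ => by ring
    have h1 : 0 ≤ (c i - 1) * (β i - ∑ j, p j * x i j) :=
      mul_nonneg (by linarith [hc1 i]) (by linarith [(hb i).2])
    have h2 := Finset.sum_nonneg hn
    have hopt : c i * β i ≤ ∑ j, v i j * x i j + β i - ∑ j, p j * x i j := by
      rcases hc i with h1 | ⟨k, hk⟩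
      · have := (h.2.2 i).2 0 (mem_budgetSet_linear.2 ⟨fun _ => le_rfl, by simpa using hβ i⟩)
        rw [utility_linear, utility_linear] at this
        simp only [Pi.zero_apply, mul_zero, Finset.sum_const_zero] at this
        rw [h1]
        linarith
      · have hpk : p k * (β i / p k) = β i := mul_div_cancel₀ _ (hp k).ne'
        have := (h.2.2 i).2 (Pi.single k (β i / p k)) (by
          rw [mem_budgetSet_linear, sum_mul_single, hpk]
          exact ⟨(Pi.single_nonneg.2 (div_nonneg (hβ i) (hp k).le) :
            (0 : Fin n → ℝ) ≤ Pi.single k (β i / p k)), le_rfl⟩)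
        rw [utility_linear, utility_linear, sum_mul_single, sum_mul_single, hpk, hk, mul_assoc,
          hpk] at this
        linarith
    have h3 : ∑ j, x i j * (c i * p j - v i j) = 0 := by linarith
    exact ⟨fun j => (Finset.sum_eq_zero_iff_of_nonneg hn).1 h3 j (Finset.mem_univ j), by linarith⟩
  have hzero : ∀ i, β i = 0 → ∀ j, x i j = 0 := fun i hi j => by
    have hn : ∀ k ∈ Finset.univ, 0 ≤ p k * x i k := fun k _ =>
      mul_nonneg (hp k).le ((hb i).1 k)
    have h0 : ∑ k, p k * x i k = 0 := le_antisymm (hi ▸ (hb i).2) (Finset.sum_nonneg hn)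
    exact (mul_eq_zero.1 ((Finset.sum_eq_zero_iff_of_nonneg hn).1 h0 j
      (Finset.mem_univ j))).resolve_left (hp j).ne'
  -- Buyers without budget buy nothing; normalising their multipliers to `1` keeps all multipliers
  -- bounded.
  refine ⟨fun i => if β i = 0 then 1 else c i, h.1, fun i => (hb i).1, h.2.1,
    fun i => (hb i).2, fun i => ?_, fun i hi j => ?_, fun i j => ?_, fun i => ?_, fun i hi => ?_⟩
  · split_ifs
    exacts [le_rfl, hc1 i]
  · rw [if_neg hi.ne']
    exact hcle i j
  · by_cases hi : β i = 0
    · rw [hzero i hi, zero_mul]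
    · rw [if_neg hi, (key i).1]
  · by_cases hi : β i = 0
    · rw [if_pos hi, sub_self, zero_mul]
    · rw [if_neg hi, (key i).2]
  · exact if_pos hi

theorem mem_feasibleRegion_iff (hβ : ∀ i, 0 ≤ β i) (hval : ∀ j, ∃ i, 0 < β i ∧ 0 < v i j)
    {p : Fin n → ℝ} : p ∈ (linear v β s).feasibleRegion ↔ ∃ x l, IsSupported v β s p x l :=
  ⟨fun ⟨x, hx⟩ => ⟨x, hx.exists_isSupported hβ hval⟩,
    fun ⟨x, _, h⟩ => ⟨x, h.isFeasibleOutcome (h.price_pos hval) hβ⟩⟩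

/-! ### The lattice property and the smallest supported prices. -/

/-- Supported prices are closed under pointwise minima. -/
theorem IsSupported.inf {p q : Fin n → ℝ} {x y : Fin m → Fin n → ℝ} {l k : Fin m → ℝ}
    (h : IsSupported v β s p x l) (h' : IsSupported v β s q y k) (hβ : ∀ i, 0 ≤ β i)
    (hval : ∀ j, ∃ i, 0 < β i ∧ 0 < v i j) :
    ∃ z c, IsSupported v β s (p ⊓ q) z c := by
  have hp := h.price_pos hval
  have hq := h'.price_pos hval
  -- On a good bought, `l i * p j = v i j ≤ k i * q j ≤ l i * q j`. Ties go to `x` here and the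
  -- inequality in `hy` is strict, so each good is sold only according to `x` or only according to
  -- `y`, and supply is respected.
  have hx : ∀ i, k i ≤ l i → ∀ j, x i j ≠ 0 → p j ≤ q j := by
    intro i hkl j hxj
    rcases (hβ i).eq_or_lt with hi | hi
    · exact absurd (h.alloc_eq_zero hp hi.symm j) hxj
    have h1 := h.valuation_eq hxj
    have h2 := h'.valuation_le i hi j
    have h3 : k i * q j ≤ l i * q j := mul_le_mul_of_nonneg_right hkl (hq j).le
    exact le_of_mul_le_mul_left (by linarith) (by linarith [h.one_le i] : 0 < l i)
  have hy : ∀ i, l i < k i → ∀ j, y i j ≠ 0 → q j < p j := by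
    intro i hkl j hyj
    rcases (hβ i).eq_or_lt with hi | hi
    · exact absurd (h'.alloc_eq_zero hq hi.symm j) hyj
    have h1 := h'.valuation_eq hyj
    have h2 := h.valuation_le i hi j
    have h3 : l i * p j < k i * p j := mul_lt_mul_of_pos_right hkl (hp j)
    exact lt_of_mul_lt_mul_left (by linarith) (by linarith [h'.one_le i] : 0 ≤ k i)
  have hinfl : ∀ j, p j ≤ q j → (p ⊓ q) j = p j := fun j hj => inf_eq_left.2 hj
  have hinfr : ∀ j, q j ≤ p j → (p ⊓ q) j = q j := fun j hj => inf_eq_right.2 hj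
  have hxs : ∀ i, k i ≤ l i → ∑ j, (p ⊓ q) j * x i j = ∑ j, p j * x i j := by
    intro i hkl
    refine Finset.sum_congr rfl fun j _ => ?_
    by_cases hxj : x i j = 0
    · rw [hxj, mul_zero, mul_zero]
    · rw [hinfl j (hx i hkl j hxj)]
  have hys : ∀ i, l i < k i → ∑ j, (p ⊓ q) j * y i j = ∑ j, q j * y i j := by
    intro i hkl
    refine Finset.sum_congr rfl fun j _ => ?_
    by_cases hyj : y i j = 0
    · rw [hyj, mul_zero, mul_zero]
    · rw [hinfr j (hy i hkl j hyj).le]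
  refine ⟨fun i => if k i ≤ l i then x i else y i, fun i => max (l i) (k i), fun j =>
    le_inf (hp j).le (hq j).le, fun i j => ?_, fun j => ?_, fun i => ?_,
    fun i => le_max_of_le_left (h.one_le i), fun i hi j => ?_, fun i j => ?_, fun i => ?_,
    fun i hi => ?_⟩
  · split_ifs
    exacts [h.alloc_nonneg i j, h'.alloc_nonneg i j]
  · rcases le_or_gt (p j) (q j) with hj | hj
    · refine (Finset.sum_le_sum fun i _ => ?_).trans (h.supply j)
      split_ifs with hkl
      · exact le_rfl
      · rw [not_le] at hkl
        have : y i j = 0 := by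
          by_contra hyj
          exact (hy i hkl j hyj).not_ge hj
        exact this ▸ h.alloc_nonneg i j
    · refine (Finset.sum_le_sum fun i _ => ?_).trans (h'.supply j)
      split_ifs with hkl
      · have : x i j = 0 := by
          by_contra hxj
          exact (hx i hkl j hxj).not_gt hj
        exact this ▸ h'.alloc_nonneg i j
      · exact le_rfl
  · split_ifs with hkl
    · exact (hxs i hkl).trans_le (h.budget i)
    · exact (hys i (not_le.1 hkl)).trans_le (h'.budget i)
  · rcases le_total (p j) (q j) with hj | hj
    · rw [hinfl j hj]
      exact (h.valuation_le i hi j).trans (mul_le_mul_of_nonneg_right (le_max_left _ _) (hp j).le)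
    · rw [hinfr j hj]
      exact (h'.valuation_le i hi j).trans
        (mul_le_mul_of_nonneg_right (le_max_right _ _) (hq j).le)
  · split_ifs with hkl
    · rw [max_eq_left hkl]
      by_cases hxj : x i j = 0
      · rw [hxj, zero_mul]
      · rw [hinfl j (hx i hkl j hxj), h.tight]
    · rw [not_le] at hkl
      rw [max_eq_right hkl.le]
      by_cases hyj : y i j = 0
      · rw [hyj, zero_mul]
      · rw [hinfr j (hy i hkl j hyj).le, h'.tight]
  · split_ifs with hkl
    · rw [max_eq_left hkl, hxs i hkl, h.exhausts]
    · rw [not_le] at hkl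
      rw [max_eq_right hkl.le, hys i hkl, h'.exhausts]
  · rw [h.eq_one i hi, h'.eq_one i hi, max_self]

/-- Stating slackness as vanishing products makes the conditions closed jointly in prices,
allocation and multipliers. -/
theorem isClosed_setOf_isSupported (v : Fin m → Fin n → ℝ) (β : Fin m → ℝ) (s : Fin n → ℝ) :
    IsClosed {w : (Fin n → ℝ) × (Fin m → Fin n → ℝ) × (Fin m → ℝ) |
      IsSupported v β s w.1 w.2.1 w.2.2} := by
  have : {w : (Fin n → ℝ) × (Fin m → Fin n → ℝ) × (Fin m → ℝ) |
      IsSupported v β s w.1 w.2.1 w.2.2} = {w | (∀ j, 0 ≤ w.1 j) ∧ (∀ i j, 0 ≤ w.2.1 i j) ∧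
      (∀ j, ∑ i, w.2.1 i j ≤ s j) ∧ (∀ i, ∑ j, w.1 j * w.2.1 i j ≤ β i) ∧ (∀ i, 1 ≤ w.2.2 i) ∧
      (∀ i, 0 < β i → ∀ j, v i j ≤ w.2.2 i * w.1 j) ∧
      (∀ i j, w.2.1 i j * (w.2.2 i * w.1 j - v i j) = 0) ∧
      (∀ i, (w.2.2 i - 1) * (β i - ∑ j, w.1 j * w.2.1 i j) = 0) ∧
      (∀ i, β i = 0 → w.2.2 i = 1)} := by
    ext w
    exact ⟨fun ⟨a, b, c, d, e, f, g, h, i⟩ => ⟨a, b, c, d, e, f, g, h, i⟩,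
      fun ⟨a, b, c, d, e, f, g, h, i⟩ => ⟨a, b, c, d, e, f, g, h, i⟩⟩
  rw [this]
  simp only [Set.ofPred_and, Set.ofPred_forall]
  refine .inter (isClosed_iInter fun j => isClosed_le (by fun_prop) (by fun_prop)) <|
    .inter (isClosed_iInter fun i => isClosed_iInter fun j =>
      isClosed_le (by fun_prop) (by fun_prop)) <|
    .inter (isClosed_iInter fun j => isClosed_le (by fun_prop) (by fun_prop)) <|
    .inter (isClosed_iInter fun i => isClosed_le (by fun_prop) (by fun_prop)) <|
    .inter (isClosed_iInter fun i => isClosed_le (by fun_prop) (by fun_prop)) <|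
    .inter (isClosed_iInter fun i => isClosed_iInter fun _ => isClosed_iInter fun j =>
      isClosed_le (by fun_prop) (by fun_prop)) <|
    .inter (isClosed_iInter fun i => isClosed_iInter fun j =>
      isClosed_eq (by fun_prop) (by fun_prop)) <|
    .inter (isClosed_iInter fun i => isClosed_eq (by fun_prop) (by fun_prop)) <|
    isClosed_iInter fun i => isClosed_iInter fun _ => isClosed_eq (by fun_prop) (by fun_prop)

theorem IsSupported.alloc_le {p : Fin n → ℝ} {x : Fin m → Fin n → ℝ} {l : Fin m → ℝ}
    (h : IsSupported v β s p x l) (i : Fin m) (j : Fin n) : x i j ≤ s j :=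
  (Finset.single_le_sum (f := fun i => x i j) (fun k _ => h.alloc_nonneg k j)
    (Finset.mem_univ i)).trans (h.supply j)

theorem exists_isLeast_supported (hv : ∀ i j, 0 ≤ v i j) (hβ : ∀ i, 0 ≤ β i) (hs : ∀ j, 0 ≤ s j)
    (hval : ∀ j, ∃ i, 0 < β i ∧ 0 < v i j) :
    ∃ p, IsLeast {p | ∃ x l, IsSupported v β s p x l} p := by
  -- No single value exceeds `P`, so selling nothing with all multipliers `1` is supported; `P` also
  -- caps prices in the compact set below.
  set P : Fin n → ℝ := fun j => ∑ i, v i j with hP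
  have hinit : IsSupported v β s P 0 1 := by
    refine ⟨fun j => Finset.sum_nonneg fun i _ => hv i j, fun _ _ => le_rfl, fun j => ?_,
      fun i => ?_, fun _ => le_rfl, fun i _ j => ?_, fun i j => ?_, fun i => ?_, fun _ _ => rfl⟩
    · simpa using hs j
    · simpa using hβ i
    · rw [Pi.one_apply, one_mul]
      exact Finset.single_le_sum (f := fun i => v i j) (fun k _ => hv k j) (Finset.mem_univ i)
    · simp
    · simp
  have hcomp : IsCompact ({w : (Fin n → ℝ) × (Fin m → Fin n → ℝ) × (Fin m → ℝ) |
      IsSupported v β s w.1 w.2.1 w.2.2} ∩ {w | w.1 ≤ P}) := by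
    refine (isCompact_Icc (a := ((0, 0, 1) : (Fin n → ℝ) × (Fin m → Fin n → ℝ) × (Fin m → ℝ)))
      (b := (P, fun _ => s, fun i => 1 + (∑ j, v i j * s j) / β i))).of_isClosed_subset
      ((isClosed_setOf_isSupported v β s).inter (isClosed_le (by fun_prop) (by fun_prop))) ?_
    rintro ⟨p, x, l⟩ ⟨h, hle⟩
    exact ⟨⟨h.price_nonneg, h.alloc_nonneg, h.one_le⟩,
      ⟨hle, fun i j => h.alloc_le i j, h.multiplier_le hv hβ hs⟩⟩
  obtain ⟨⟨p, x, l⟩, ⟨h, hle⟩, hmin⟩ := hcomp.exists_isMinOn ⟨(P, 0, 1), hinit, le_refl P⟩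
    (f := fun w => ∑ j, w.1 j) (by fun_prop)
  refine ⟨p, ⟨x, l, h⟩, ?_⟩
  rintro q ⟨y, k, h'⟩
  obtain ⟨z, c, hz⟩ := h.inf h' hβ hval
  -- A minimiser of the price sum cannot be improved by meeting it with `q`, hence lies below `q`.
  have h1 : ∑ j, p j ≤ ∑ j, (p ⊓ q) j :=
    hmin (show (p ⊓ q, z, c) ∈ _ from ⟨hz, show p ⊓ q ≤ P from inf_le_left.trans hle⟩)
  have h2 : ∀ j ∈ Finset.univ, (p ⊓ q) j ≤ p j := fun j _ => inf_le_left
  have h3 := (Finset.sum_eq_sum_iff_of_le h2).1 (le_antisymm (Finset.sum_le_sum h2) h1)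
  exact fun j => inf_eq_left.1 (h3 j (Finset.mem_univ j))

/-! ### Market clearing at the smallest prices. -/

theorem sum_update_alloc (F : (Fin n → ℝ) → ℝ) (x : Fin m → Fin n → ℝ) (i : Fin m)
    (y : Fin n → ℝ) :
    ∑ k, F (Function.update x i y k) = ∑ k, F (x k) + (F y - F (x i)) := by
  rw [← sub_eq_iff_eq_add', ← Finset.sum_sub_distrib, Finset.sum_eq_single i]
  · rw [Function.update_self]
  · intro k _ hk
    rw [Function.update_of_ne hk, sub_self]
  · exact fun hi => absurd (Finset.mem_univ i) hi

theorem IsSupported.update {p : Fin n → ℝ} {x : Fin m → Fin n → ℝ} {l : Fin m → ℝ}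
    (h : IsSupported v β s p x l) (i : Fin m) (y : Fin n → ℝ) (hy : ∀ j, 0 ≤ y j)
    (hsup : ∀ j, ∑ k, x k j + (y j - x i j) ≤ s j) (hbud : ∑ j, p j * y j ≤ β i)
    (htight : ∀ j, y j * (l i * p j - v i j) = 0)
    (hex : (l i - 1) * (β i - ∑ j, p j * y j) = 0) :
    IsSupported v β s p (Function.update x i y) l := by
  refine ⟨h.price_nonneg, fun k j => ?_, fun j => ?_, fun k => ?_, h.one_le, h.valuation_le,
    fun k j => ?_, fun k => ?_, h.eq_one⟩
  · rcases eq_or_ne k i with rfl | hk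
    · rw [Function.update_self]
      exact hy j
    · rw [Function.update_of_ne hk]
      exact h.alloc_nonneg k j
  · exact (sum_update_alloc (fun z => z j) x i y).trans_le (hsup j)
  · rcases eq_or_ne k i with rfl | hk
    · rwa [Function.update_self]
    · rw [Function.update_of_ne hk]
      exact h.budget k
  · rcases eq_or_ne k i with rfl | hk
    · rw [Function.update_self]
      exact htight j
    · rw [Function.update_of_ne hk]
      exact h.tight k j
  · rcases eq_or_ne k i with rfl | hk
    · rwa [Function.update_self]
    · rw [Function.update_of_ne hk]
      exact h.exhausts k

/-- The goods that the allocation `x` sells out. -/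
noncomputable def soldOut (s : Fin n → ℝ) (x : Fin m → Fin n → ℝ) : Finset (Fin n) :=
  Finset.univ.filter fun j => s j ≤ ∑ i, x i j

theorem mem_soldOut {x : Fin m → Fin n → ℝ} {j : Fin n} :
    j ∈ soldOut s x ↔ s j ≤ ∑ i, x i j := by
  simp [soldOut]

/-- The seller's revenue. -/
def revenue (p : Fin n → ℝ) (x : Fin m → Fin n → ℝ) : ℝ :=
  ∑ i, ∑ j, p j * x i j

/-- Some allocation maximises revenue and, among the revenue-maximising ones, sells out a minimal
set of goods. -/
theorem IsSupported.exists_maximal {p : Fin n → ℝ} {x : Fin m → Fin n → ℝ} {l : Fin m → ℝ}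
    (h : IsSupported v β s p x l) :
    ∃ y, IsSupported v β s p y l ∧ (∀ z, IsSupported v β s p z l → revenue p z ≤ revenue p y) ∧
      ∀ z, IsSupported v β s p z l → revenue p z = revenue p y →
        ¬ soldOut s z ⊂ soldOut s y := by
  have hcomp : IsCompact {y | IsSupported v β s p y l} := by
    refine (isCompact_Icc (a := (0 : Fin m → Fin n → ℝ)) (b := fun _ => s)).of_isClosed_subset
      ((isClosed_setOf_isSupported v β s).preimage (f := fun y => (p, y, l)) (by fun_prop)) ?_
    exact fun y hy => ⟨hy.alloc_nonneg, fun i j => hy.alloc_le i j⟩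
  obtain ⟨y₀, hy₀, hmax⟩ := hcomp.exists_isMaxOn ⟨x, h⟩ (f := revenue p)
    (by unfold revenue; fun_prop)
  obtain ⟨y, ⟨hy, hyr⟩, hmin⟩ := (measure fun y => (soldOut s y).card).wf.has_min
    {y | IsSupported v β s p y l ∧ revenue p y = revenue p y₀} ⟨y₀, hy₀, rfl⟩
  exact ⟨y, hy, fun z hz => hyr ▸ hmax hz, fun z hz hzr hss =>
    hmin z ⟨hz, hzr.trans hyr⟩ (Finset.card_lt_card hss)⟩

/-- In a revenue-maximising allocation, a buyer who is willing to buy a good that is not sold out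
spends his whole budget. -/
theorem IsSupported.spend_eq_of_undersold {p : Fin n → ℝ} {x : Fin m → Fin n → ℝ} {l : Fin m → ℝ}
    (h : IsSupported v β s p x l) (hp : ∀ j, 0 < p j)
    (hmax : ∀ z, IsSupported v β s p z l → revenue p z ≤ revenue p x) {i : Fin m} {j : Fin n}
    (hj : ∑ k, x k j < s j) (hij : v i j = l i * p j) : ∑ k, p k * x i k = β i := by
  by_contra hne
  have hlt : ∑ k, p k * x i k < β i := (h.budget i).lt_of_ne hne
  have hl : l i = 1 := by
    have := (mul_eq_zero.1 (h.exhausts i)).resolve_right (by linarith)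
    linarith
  -- As much of good `j` as remaining supply and leftover money allow; buying it would raise
  -- revenue.
  set ε := min (s j - ∑ k, x k j) ((β i - ∑ k, p k * x i k) / p j) with hε
  have hε0 : 0 < ε := lt_min (by linarith) (div_pos (by linarith) (hp j))
  have hε1 : ε ≤ s j - ∑ k, x k j := min_le_left _ _
  have hε2 : p j * ε ≤ β i - ∑ k, p k * x i k := by
    rw [mul_comm]
    exact (le_div_iff₀ (hp j)).1 (min_le_right _ _)
  have hsupp : IsSupported v β s p (Function.update x i (x i + Pi.single j ε)) l := by
    refine h.update i _ (fun k => ?_) (fun k => ?_) ?_ (fun k => ?_) ?_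
    · exact add_nonneg (h.alloc_nonneg i k)
        ((Pi.single_nonneg.2 hε0.le : (0 : Fin n → ℝ) ≤ Pi.single j ε) k)
    · rw [Pi.add_apply, add_sub_cancel_left]
      rcases eq_or_ne k j with rfl | hk
      · rw [Pi.single_eq_same]
        linarith
      · rw [Pi.single_eq_of_ne hk, add_zero]
        exact h.supply k
    · rw [sum_mul_add_single]
      linarith
    · rw [Pi.add_apply, add_mul, h.tight i k, zero_add]
      rcases eq_or_ne k j with rfl | hk
      · rw [hij, sub_self, mul_zero]
      · rw [Pi.single_eq_of_ne hk, zero_mul]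
    · rw [hl, sub_self, zero_mul]
  have h1 := hmax _ hsupp
  unfold revenue at h1
  rw [sum_update_alloc (fun z => ∑ k, p k * z k), sum_mul_add_single] at h1
  have := mul_pos (hp j) hε0
  linarith

/-- If the set of sold-out goods is minimal, a buyer who is willing to buy a good that is not sold
out buys no sold-out goods. -/
theorem IsSupported.undersold_of_undersold {p : Fin n → ℝ} {x : Fin m → Fin n → ℝ} {l : Fin m → ℝ}
    (h : IsSupported v β s p x l) (hp : ∀ j, 0 < p j)
    (hmin : ∀ z, IsSupported v β s p z l → revenue p z = revenue p x →
      ¬ soldOut s z ⊂ soldOut s x) {i : Fin m} {j : Fin n}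
    (hj : ∑ k, x k j < s j) (hij : v i j = l i * p j) {g : Fin n} (hg : x i g ≠ 0) :
    ∑ k, x k g < s g := by
  by_contra hsg
  have hgj : g ≠ j := fun e => hsg (e ▸ hj)
  have hxg : 0 < x i g := (h.alloc_nonneg i g).lt_of_ne hg.symm
  -- An amount of money moved from `g` to `j`. Revenue is unchanged and `g` stops being sold out,
  -- while the factor `1 / 2` keeps `j` undersold.
  set ε := min (p g * x i g) (p j * ((s j - ∑ k, x k j) / 2)) with hε
  have hε0 : 0 < ε := lt_min (mul_pos (hp g) hxg) (mul_pos (hp j) (by linarith))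
  have hεg : ε / p g ≤ x i g := (div_le_iff₀' (hp g)).2 (min_le_left _ _)
  have hεj : ε / p j ≤ (s j - ∑ k, x k j) / 2 := (div_le_iff₀' (hp j)).2 (min_le_right _ _)
  have hεg0 : 0 < ε / p g := div_pos hε0 (hp g)
  have hεj0 : 0 < ε / p j := div_pos hε0 (hp j)
  set y : Fin n → ℝ := x i + Pi.single j (ε / p j) + Pi.single g (-(ε / p g)) with hy
  have hyj : y j = x i j + ε / p j := by simp [hy, hgj.symm]
  have hyg : y g = x i g - ε / p g := by simp [hy, hgj, sub_eq_add_neg]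
  have hyk : ∀ k, k ≠ j → k ≠ g → y k = x i k := fun k h1 h2 => by simp [hy, h1, h2]
  have hspend : ∑ k, p k * y k = ∑ k, p k * x i k := by
    rw [hy, sum_mul_add_single, sum_mul_add_single, mul_neg, mul_div_cancel₀ _ (hp j).ne',
      mul_div_cancel₀ _ (hp g).ne']
    ring
  have hsupp : IsSupported v β s p (Function.update x i y) l := by
    refine h.update i y (fun k => ?_) (fun k => ?_) (hspend.trans_le (h.budget i)) (fun k => ?_)
      (hspend.symm ▸ h.exhausts i)
    · rcases eq_or_ne k j with rfl | hkj
      · linarith [h.alloc_nonneg i k]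
      rcases eq_or_ne k g with rfl | hkg
      · linarith
      · exact hyk k hkj hkg ▸ h.alloc_nonneg i k
    · rcases eq_or_ne k j with rfl | hkj
      · linarith
      rcases eq_or_ne k g with rfl | hkg
      · linarith [h.supply k]
      · linarith [hyk k hkj hkg, h.supply k]
    · rcases eq_or_ne k j with rfl | hkj
      · rw [hij, sub_self, mul_zero]
      rcases eq_or_ne k g with rfl | hkg
      · rw [h.valuation_eq hg, sub_self, mul_zero]
      · rw [hyk k hkj hkg, h.tight]
  refine hmin _ hsupp ?_ ((Finset.ssubset_iff_of_subset fun k hk => ?_).2 ⟨g, ?_, fun hk => ?_⟩)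
  · unfold revenue
    rw [sum_update_alloc (fun z => ∑ k, p k * z k), hspend, sub_self, add_zero]
  · rw [mem_soldOut, sum_update_alloc (fun z => z k)] at hk
    rw [mem_soldOut]
    rcases eq_or_ne k j with rfl | hkj
    · linarith
    rcases eq_or_ne k g with rfl | hkg
    · linarith
    · linarith [hyk k hkj hkg]
  · exact mem_soldOut.2 (not_lt.1 hsg)
  · rw [mem_soldOut, sum_update_alloc (fun z => z g)] at hk
    linarith [h.supply g]

/-- Prices of undersold goods can be lowered when the buyers willing to buy such goods spend their
whole budget on them. -/
theorem IsSupported.exists_lower {p : Fin n → ℝ} {x : Fin m → Fin n → ℝ} {l : Fin m → ℝ}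
    (h : IsSupported v β s p x l) (hp : ∀ j, 0 < p j) (hβ : ∀ i, 0 ≤ β i)
    (hspend : ∀ i j, ∑ k, x k j < s j → v i j = l i * p j → ∑ k, p k * x i k = β i)
    (hbuy : ∀ i j, ∑ k, x k j < s j → v i j = l i * p j → ∀ g, x i g ≠ 0 →
      ∑ k, x k g < s g) {j₀ : Fin n} (hj₀ : ∑ k, x k j₀ < s j₀) :
    ∃ q y c, IsSupported v β s q y c ∧ q j₀ < p j₀ := by
  classical
  -- A factor `t < 1` so close to `1` that strict inequalities in supply and in valuation survive.
  have hev : ∀ᶠ t : ℝ in nhdsWithin 1 (Set.Iio 1), 0 < t ∧ t < 1 ∧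
      (∀ j, ∑ k, x k j < s j → ∑ k, x k j < t * s j) ∧
      ∀ i j, v i j < l i * p j → v i j < l i * (t * p j) := by
    have aux : ∀ (f : ℝ → ℝ) (a : ℝ), Continuous f → a < f 1 →
        ∀ᶠ t : ℝ in nhdsWithin 1 (Set.Iio 1), a < f t := fun f a hf ha =>
      (hf.continuousAt.eventually_const_lt ha).filter_mono nhdsWithin_le_nhds
    refine (aux id 0 continuous_id one_pos).and (eventually_mem_nhdsWithin.and
      (.and ?_ ?_))
    · refine Filter.eventually_all.2 fun j => ?_
      by_cases hj : ∑ k, x k j < s j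
      · exact (aux (fun t => t * s j) _ (by fun_prop) (by simpa using hj)).mono fun t ht _ => ht
      · exact .of_forall fun t ht => absurd ht hj
    · refine Filter.eventually_all.2 fun i => Filter.eventually_all.2 fun j => ?_
      by_cases hij : v i j < l i * p j
      · exact (aux (fun t => l i * (t * p j)) _ (by fun_prop) (by simpa using hij)).mono
          fun t ht _ => ht
      · exact .of_forall fun t ht => absurd ht hij
  obtain ⟨t, ht0, ht1, hts, htv⟩ := hev.exists
  -- For buyers in `T`, quantities and multipliers are divided by `t`: spending and `l i * p j` on
  -- undersold goods are unchanged. Other buyers hold no undersold goods and keep their bundles.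
  set T : Fin m → Prop := fun i => 0 < β i ∧ ∃ j, ∑ k, x k j < s j ∧ v i j = l i * p j with hT
  set q : Fin n → ℝ := fun j => if ∑ k, x k j < s j then t * p j else p j with hq
  have hqU : ∀ j, ∑ k, x k j < s j → q j = t * p j := fun j hj => if_pos hj
  have hqN : ∀ j, ¬ ∑ k, x k j < s j → q j = p j := fun j hj => if_neg hj
  have hTU : ∀ i, T i → ∀ j, x i j ≠ 0 → ∑ k, x k j < s j :=
    fun i ⟨_, j, hj, hij⟩ g hg => hbuy i j hj hij g hg
  have hTN : ∀ i, ¬ T i → ∀ j, ∑ k, x k j < s j → x i j = 0 := by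
    intro i hi j hj
    rcases (hβ i).eq_or_lt with hi0 | hi0
    · exact h.alloc_eq_zero hp hi0.symm j
    · by_contra hxj
      exact hi ⟨hi0, j, hj, h.valuation_eq hxj⟩
  have hsT : ∀ i, T i → ∑ j, q j * (x i j / t) = ∑ j, p j * x i j := fun i hi =>
    Finset.sum_congr rfl fun j _ => by
      by_cases hxj : x i j = 0
      · simp [hxj]
      · rw [hqU j (hTU i hi j hxj)]
        field_simp
  have hsN : ∀ i, ¬ T i → ∑ j, q j * x i j = ∑ j, p j * x i j := fun i hi =>
    Finset.sum_congr rfl fun j _ => by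
      by_cases hj : ∑ k, x k j < s j
      · rw [hTN i hi j hj, mul_zero, mul_zero]
      · rw [hqN j hj]
  have hl : ∀ i, 0 < l i := fun i => by linarith [h.one_le i]
  have hle : ∀ i, l i ≤ l i / t := fun i => le_div_self (hl i).le ht0 ht1.le
  refine ⟨q, fun i j => if T i then x i j / t else x i j, fun i => if T i then l i / t else l i,
    ⟨fun j => ?_, fun i j => ?_, fun j => ?_, fun i => ?_, fun i => ?_, fun i hi j => ?_,
      fun i j => ?_, fun i => ?_, fun i hi => ?_⟩, ?_⟩
  · by_cases hj : ∑ k, x k j < s j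
    · exact hqU j hj ▸ (mul_pos ht0 (hp j)).le
    · exact hqN j hj ▸ (hp j).le
  · split_ifs
    exacts [div_nonneg (h.alloc_nonneg i j) ht0.le, h.alloc_nonneg i j]
  · by_cases hj : ∑ k, x k j < s j
    · calc ∑ i, (if T i then x i j / t else x i j) ≤ ∑ i, x i j / t :=
            Finset.sum_le_sum fun i _ => by
              split_ifs with hi
              · exact le_rfl
              · exact le_div_self (h.alloc_nonneg i j) ht0 ht1.le
        _ = (∑ i, x i j) / t := (Finset.sum_div _ _ _).symm
        _ ≤ s j := (div_le_iff₀' ht0).2 (hts j hj).le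
    · refine (Finset.sum_le_sum fun i _ => ?_).trans (h.supply j)
      split_ifs with hi
      · have : x i j = 0 := by
          by_contra hxj
          exact hj (hTU i hi j hxj)
        rw [this, zero_div]
      · exact le_rfl
  · split_ifs with hi
    · exact (hsT i hi).trans_le (h.budget i)
    · exact (hsN i hi).trans_le (h.budget i)
  · split_ifs
    exacts [(h.one_le i).trans (hle i), h.one_le i]
  · split_ifs with hiT
    · by_cases hj : ∑ k, x k j < s j
      · have : l i / t * (t * p j) = l i * p j := by field_simp
        rw [hqU j hj, this]
        exact h.valuation_le i hi j
      · rw [hqN j hj]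
        exact (h.valuation_le i hi j).trans (mul_le_mul_of_nonneg_right (hle i) (hp j).le)
    · by_cases hj : ∑ k, x k j < s j
      · rw [hqU j hj]
        exact (htv i j ((h.valuation_le i hi j).lt_of_ne fun e => hiT ⟨hi, j, hj, e⟩)).le
      · rw [hqN j hj]
        exact h.valuation_le i hi j
  · split_ifs with hi
    · by_cases hxj : x i j = 0
      · simp [hxj]
      · have : l i / t * (t * p j) = l i * p j := by field_simp
        rw [hqU j (hTU i hi j hxj), this, h.valuation_eq hxj, sub_self, mul_zero]
    · by_cases hj : ∑ k, x k j < s j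
      · rw [hTN i hi j hj, zero_mul]
      · rw [hqN j hj, h.tight]
  · split_ifs with hi
    · obtain ⟨-, j, hj, hij⟩ := id hi
      rw [hsT i hi, hspend i j hj hij, sub_self, mul_zero]
    · rw [hsN i hi, h.exhausts]
  · rw [if_neg fun hiT => hiT.1.ne' hi, h.eq_one i hi]
  · rw [hqU j₀ hj₀]
    exact mul_lt_of_lt_one_left (hp j₀) ht1

/-- At the smallest supported prices all goods can be sold out. -/
theorem exists_clearing_of_isLeast (hβ : ∀ i, 0 ≤ β i)
    (hval : ∀ j, ∃ i, 0 < β i ∧ 0 < v i j) {p : Fin n → ℝ}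
    (hp : IsLeast {p | ∃ x l, IsSupported v β s p x l} p) :
    ∃ x l, IsSupported v β s p x l ∧ ∀ j, ∑ i, x i j = s j := by
  obtain ⟨⟨x₀, l, h₀⟩, hleast⟩ := hp
  have hpos := h₀.price_pos hval
  obtain ⟨x, h, hmax, hmin⟩ := h₀.exists_maximal
  refine ⟨x, l, h, fun j => (h.supply j).antisymm ?_⟩
  by_contra hj
  obtain ⟨q, y, c, hq, hlt⟩ := h.exists_lower hpos hβ
    (fun i j hj hij => h.spend_eq_of_undersold hpos hmax hj hij)
    (fun i j hj hij g hg => h.undersold_of_undersold hpos hmin hj hij hg) (not_le.1 hj)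
  exact hlt.not_ge (hleast ⟨y, c, hq⟩ j)

/-! ### Uniqueness of clearing prices. -/

/-- Clearing prices that dominate supported prices agree with them for all goods in supply. -/
theorem IsSupported.eq_of_clearing {p q : Fin n → ℝ} {x y : Fin m → Fin n → ℝ} {l k : Fin m → ℝ}
    (h : IsSupported v β s p x l) (h' : IsSupported v β s q y k) (hβ : ∀ i, 0 ≤ β i)
    (hval : ∀ j, ∃ i, 0 < β i ∧ 0 < v i j) (hpq : p ≤ q) (hclear : ∀ j, ∑ i, y i j = s j)
    {j : Fin n} (hj : 0 < s j) : q j = p j := by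
  classical
  have hp := h.price_pos hval
  have hq := h'.price_pos hval
  by_contra hne
  have hjlt : p j < q j := (hpq j).lt_of_ne (Ne.symm hne)
  set E : Finset (Fin n) := Finset.univ.filter fun j => p j < q j with hE
  have hmem : ∀ g, g ∈ E ↔ p g < q g := fun g => by simp [hE]
  -- A buyer of some good in `E` at `q` has `k i < l i`. Hence at `p` he exhausts his budget, and
  -- only on goods in `E`.
  have hspend : ∀ i, ∑ g ∈ E, q g * y i g ≤ ∑ g ∈ E, p g * x i g := by
    intro i
    by_cases hex : ∃ g ∈ E, y i g ≠ 0
    · obtain ⟨g, hgE, hg⟩ := hex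
      have hi : 0 < β i := (hβ i).lt_of_ne fun h0 => hg (h'.alloc_eq_zero hq h0.symm g)
      have hk : 0 < k i := by linarith [h'.one_le i]
      have hkl : k i < l i := by
        have h1 := h'.valuation_eq hg
        have h2 := h.valuation_le i hi g
        have h3 := mul_lt_mul_of_pos_left ((hmem g).1 hgE) hk
        exact lt_of_mul_lt_mul_right (by linarith) (hp g).le
      have hx : ∀ f, f ∉ E → p f * x i f = 0 := by
        intro f hf
        by_contra hxf
        have hxf' : x i f ≠ 0 := right_ne_zero_of_mul hxf
        have h1 := h.valuation_eq hxf'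
        have h2 := h'.valuation_le i hi f
        have h3 := mul_lt_mul_of_pos_right hkl (hq f)
        exact hf ((hmem f).2 (lt_of_mul_lt_mul_left (by linarith) (hk.trans hkl).le))
      calc ∑ g ∈ E, q g * y i g ≤ ∑ g, q g * y i g :=
            Finset.sum_le_univ_sum_of_nonneg fun g => mul_nonneg (hq g).le (h'.alloc_nonneg i g)
        _ ≤ β i := h'.budget i
        _ = ∑ g, p g * x i g := (h.spend_eq ((h'.one_le i).trans_lt hkl)).symm
        _ = ∑ g ∈ E, p g * x i g :=
            (Finset.sum_subset (Finset.subset_univ E) fun f _ hf => hx f hf).symm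
    · push Not at hex
      rw [Finset.sum_eq_zero fun g hg => by rw [hex g hg, mul_zero]]
      exact Finset.sum_nonneg fun g _ => mul_nonneg (hp g).le (h.alloc_nonneg i g)
  have hs0 : ∀ g, 0 ≤ s g := fun g => hclear g ▸ Finset.sum_nonneg fun i _ => h'.alloc_nonneg i g
  have htotal : ∑ g ∈ E, q g * s g ≤ ∑ g ∈ E, p g * s g :=
    calc ∑ g ∈ E, q g * s g = ∑ i, ∑ g ∈ E, q g * y i g := by
          rw [Finset.sum_comm]
          exact Finset.sum_congr rfl fun g _ => by rw [← Finset.mul_sum, hclear]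
      _ ≤ ∑ i, ∑ g ∈ E, p g * x i g := Finset.sum_le_sum fun i _ => hspend i
      _ ≤ ∑ g ∈ E, p g * s g := by
          rw [Finset.sum_comm]
          refine Finset.sum_le_sum fun g _ => ?_
          rw [← Finset.mul_sum]
          exact mul_le_mul_of_nonneg_left (h.supply g) (hp g).le
  exact htotal.not_gt (Finset.sum_lt_sum
    (fun g _ => mul_le_mul_of_nonneg_right (hpq g) (hs0 g))
    ⟨j, (hmem j).2 hjlt, mul_lt_mul_of_pos_right hjlt hj⟩)

end Market

theorem mainTheorem5 (m n : ℕ) (v : Fin m → Fin n → ℝ) (β : Fin m → ℝ) (s : Fin n → ℝ)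
    (hv : ∀ i j, 0 ≤ v i j) (hβ : ∀ i, 0 ≤ β i) (hs : ∀ j, 0 ≤ s j)
    (hval : ∀ j, ∃ i, 0 < β i ∧ 0 < v i j) :
    ∃ p : Fin n → ℝ,
      IsLeast (Market.linear v β s).feasibleRegion p ∧
      (Market.linear v β s).IsMarketClearing p ∧
      (∀ q, (Market.linear v β s).IsMarketClearing q → ∀ j, 0 < s j → q j = p j) ∧
      ((∀ j, 0 < s j) → ∀ q, (Market.linear v β s).IsMarketClearing q ↔ q = p) := by
  obtain ⟨p, hp⟩ := Market.exists_isLeast_supported hv hβ hs hval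
  have hregion : (Market.linear v β s).feasibleRegion =
      {p | ∃ x l, Market.IsSupported v β s p x l} :=
    Set.ext fun _ => Market.mem_feasibleRegion_iff hβ hval
  obtain ⟨x, l, h, hclear⟩ := Market.exists_clearing_of_isLeast hβ hval hp
  have hmc : (Market.linear v β s).IsMarketClearing p :=
    ⟨x, h.isFeasibleOutcome (h.price_pos hval) hβ, fun j _ => hclear j⟩
  have huniq : ∀ q, (Market.linear v β s).IsMarketClearing q → ∀ j, 0 < s j → q j = p j := by
    rintro q ⟨y, hy, hyc⟩ j hj
    obtain ⟨k, h'⟩ := hy.exists_isSupported hβ hval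
    exact h.eq_of_clearing h' hβ hval (hp.2 ⟨y, k, h'⟩)
      (fun g => hyc g (h'.price_pos hval g)) hj
  exact ⟨p, hregion ▸ hp, hmc, huniq, fun hpos q =>
    ⟨fun hq => funext fun j => huniq q hq j (hpos j), fun hq => hq ▸ hmc⟩⟩
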